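/- **Setting.** $n$ users are placed independently and uniformly at random in the unit square $[0,1]^2$ and do not move. Two distinct users can communicate directly when their distance is less than the coverage radius $r_{cov}>0$; this gives the random geometric graph $G(n,r_{cov})$. A message is forwarded by everyone who receives it, so a message known to a user $j$ reaches exactly the connected component of $j$. Let $\mathit{aVd}>0$ and $\mathit{mVu}\in\mathbb N$ be the block-creation parameters: a transaction that reaches exactly the users in a set $T$ can be put into a block if some set $S\subseteq T$ of at least $\mathit{mVu}$ users has average distance (over pairs of distinct users of $S$, taken to be $0$ if $S$ has fewer than two users) larger than $\mathit{aVd}$. A passive double-spending attack *can succeed* if there are receivers $j_1,j_2$ of two conflicting transactions such that no user is reached by both transactions (such a user would detect the attempt), and each of the two transactions can be put into a block by users that it reaches. Write $\lambda=\mathit{aVd}/r_{cov}$, and let $d_{\mathcal D}=\pi n r_{cov}^2(1+o(1))$ be the degree of the graph as $n\to\infty$; only the upper bound $d_{\mathcal D}\le \pi n r_{cov}^2(1+\varepsilon_n)$ with $\varepsilon_n\to0$ is used. **Theorem.** Let $(\varepsilon_n)$ be a real sequence with $\varepsilon_n\to 0$. There is an $N$, depending only on this sequence, such that the following holds for all $n\ge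 N$, all real $r_{cov}>0$ and $\mathit{aVd}>0$, all $\mathit{mVu}\in\mathbb N$, and all real $d_{\mathcal D}\le \pi n r_{cov}^2(1+\varepsilon_n)$. If $$ n\Big(\frac{\mathit{aVd}}{\lambda}\Big)^2\ \ge\ 2\log n \qquad\text{and}\qquad \lambda\, d_{\mathcal D}\ >\ \frac n2 ,\qquad \lambda=\frac{\mathit{aVd}}{r_{cov}},$$ then the probability that a passive double-spending attack can succeed is at most $1/n^2$. -/

import Mathlib

open MeasureTheory Filter Topology

noncomputable section

/-- The area in which the service is deployed, normalised to the unit square. -/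
def serviceArea : Set (EuclideanSpace ℝ (Fin 2)) :=
  {x | ∀ k, x k ∈ Set.Icc (0 : ℝ) 1}

/-- The joint law of the locations of `n` static users, placed independently and uniformly
in the unit square (which has area one). -/
def locationLaw (n : ℕ) : Measure (Fin n → EuclideanSpace ℝ (Fin 2)) :=
  Measure.pi fun _ => (volume : Measure (EuclideanSpace ℝ (Fin 2))).restrict serviceArea

/-- The geometric graph of the users: two distinct users can communicate directly when their
distance is less than the coverage radius `r`. With random locations this is the random
geometric graph. -/
def coverageGraph {n : ℕ} (loc : Fin n → EuclideanSpace ℝ (Fin 2)) (r : ℝ) :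
    SimpleGraph (Fin n) where
  Adj i j := i ≠ j ∧ dist (loc i) (loc j) < r
  symm := ⟨fun i j h => ⟨h.1.symm, by rw [dist_comm]; exact h.2⟩⟩
  loopless := ⟨fun _ h => h.1 rfl⟩

/-- The users that a message known to user `j` reaches: every user forwards what she receives,
so these are the users in the connected component of `j`. -/
def audience {n : ℕ} (loc : Fin n → EuclideanSpace ℝ (Fin 2)) (r : ℝ) (j : Fin n) :
    Set (Fin n) :=
  {u | (coverageGraph loc r).Reachable j u}

/-- The average distance between two distinct users of `S`
(it is `0` when `S` has fewer than two members). -/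
def averageDistance {n : ℕ} (loc : Fin n → EuclideanSpace ℝ (Fin 2)) (S : Finset (Fin n)) : ℝ :=
  (∑ p ∈ S.offDiag, dist (loc p.1) (loc p.2)) / (S.offDiag.card : ℝ)

/-- A block can be created among the users in `T`: some set of at least `mVu` of them, with
average distance larger than `aVd`, can act as its verifiers. -/
def BlockCreatable {n : ℕ} (loc : Fin n → EuclideanSpace ℝ (Fin 2)) (aVd : ℝ) (mVu : ℕ)
    (T : Set (Fin n)) : Prop :=
  ∃ S : Finset (Fin n), (S : Set (Fin n)) ⊆ T ∧ mVu ≤ S.card ∧ aVd < averageDistance loc S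

/-- A passive double-spending attack can succeed: there are receivers `j₁`, `j₂` of two
conflicting transactions such that no user gets both transactions (such a user would detect the
attempt), and each of the two transactions gets into a block, verified by users that it
reaches. -/
def PassiveDoubleSpending {n : ℕ} (loc : Fin n → EuclideanSpace ℝ (Fin 2)) (r aVd : ℝ)
    (mVu : ℕ) : Prop :=
  ∃ j₁ j₂ : Fin n,
    Disjoint (audience loc r j₁) (audience loc r j₂) ∧
    BlockCreatable loc aVd mVu (audience loc r j₁) ∧
    BlockCreatable loc aVd mVu (audience loc r j₂)

end

/-! The condition `lam * d > n / 2` bounds `aVd * r` below by about `1 / (2π)`. If `aVd ≥ 2`, no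
block can be created, since distances in the square are at most 2
(`PassiveDoubleSpending.aVd_lt_two`). If `aVd < 2`, then `r` exceeds the constant 3/50. Cut the
square into a fixed 50 × 50 grid: once every cell is occupied the graph is connected, and two
audiences cannot be disjoint. By a union bound some cell is empty with probability at most `2500 (1
- 1/2500)^n`, eventually below `1 / n^2` (`locationLaw_not_preconnected_le`). -/

lemma dist_le_abs_add_abs (x y : EuclideanSpace ℝ (Fin 2)) :
    dist x y ≤ |x 0 - y 0| + |x 1 - y 1| := by
  rw [EuclideanSpace.dist_eq, Fin.sum_univ_two, Real.dist_eq, Real.dist_eq]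
  refine Real.sqrt_le_iff.2 ⟨by positivity, ?_⟩
  nlinarith [mul_nonneg (abs_nonneg (x 0 - y 0)) (abs_nonneg (x 1 - y 1))]

lemma dist_le_two_of_mem_serviceArea {x y : EuclideanSpace ℝ (Fin 2)}
    (hx : x ∈ serviceArea) (hy : y ∈ serviceArea) : dist x y ≤ 2 := by
  have h (k : Fin 2) : |x k - y k| ≤ 1 := by
    obtain ⟨h₁, h₂⟩ := hx k
    obtain ⟨h₃, h₄⟩ := hy k
    exact abs_le.2 ⟨by linarith, by linarith⟩
  linarith [dist_le_abs_add_abs x y, h 0, h 1]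

lemma averageDistance_le_two {n : ℕ} {loc : Fin n → EuclideanSpace ℝ (Fin 2)}
    (hloc : ∀ i, loc i ∈ serviceArea) (S : Finset (Fin n)) : averageDistance loc S ≤ 2 := by
  refine div_le_of_le_mul₀ (by positivity) (by norm_num) ?_
  calc ∑ p ∈ S.offDiag, dist (loc p.1) (loc p.2) ≤ ∑ _p ∈ S.offDiag, (2 : ℝ) :=
        Finset.sum_le_sum fun p _ => dist_le_two_of_mem_serviceArea (hloc _) (hloc _)
    _ = 2 * (S.offDiag.card : ℝ) := by rw [Finset.sum_const, nsmul_eq_mul, mul_comm]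

/-- The closed cell in column `a` and row `b` of the `K × K` subdivision of the unit square. -/
def gridCell (K a b : ℕ) : Set (EuclideanSpace ℝ (Fin 2)) :=
  {x | ∀ k, x k ∈ Set.Icc ((![a, b] k : ℝ) / K) ((![a, b] k + 1 : ℝ) / K)}

lemma gridCell_eq_preimage (K a b : ℕ) :
    gridCell K a b = WithLp.ofLp ⁻¹'
      Set.Icc (fun k => (![a, b] k : ℝ) / K) (fun k => (![a, b] k + 1 : ℝ) / K) := by
  ext x
  simp only [gridCell, Set.mem_ofPred_eq, Set.mem_preimage, Set.mem_Icc, Pi.le_def, forall_and]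

lemma measurableSet_gridCell (K a b : ℕ) : MeasurableSet (gridCell K a b) := by
  rw [gridCell_eq_preimage]
  exact WithLp.measurable_ofLp 2 (Fin 2 → ℝ) measurableSet_Icc

lemma volume_gridCell (K a b : ℕ) :
    volume (gridCell K a b) = ENNReal.ofReal (1 / (K : ℝ) ^ 2) := by
  rw [gridCell_eq_preimage,
    (PiLp.volume_preserving_ofLp (Fin 2)).measure_preimage
      measurableSet_Icc.nullMeasurableSet, Real.volume_Icc_pi, Fin.prod_univ_two,
    ← ENNReal.ofReal_mul (by rw [← sub_div]; simp)]
  congr 1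
  ring

lemma serviceArea_eq_gridCell : serviceArea = gridCell 1 0 0 := by
  ext x
  simp [serviceArea, gridCell, Fin.forall_fin_two]

lemma measurableSet_serviceArea : MeasurableSet serviceArea :=
  serviceArea_eq_gridCell ▸ measurableSet_gridCell 1 0 0

instance : IsProbabilityMeasure
    ((volume : Measure (EuclideanSpace ℝ (Fin 2))).restrict serviceArea) :=
  ⟨by rw [Measure.restrict_apply_univ, serviceArea_eq_gridCell, volume_gridCell]; simp⟩

lemma gridCell_subset_serviceArea {K a b : ℕ} (ha : a < K) (hb : b < K) :
    gridCell K a b ⊆ serviceArea := by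
  intro x hx
  have hK : (0 : ℝ) < K := by exact_mod_cast (Nat.zero_le a).trans_lt ha
  have ha' : (a : ℝ) + 1 ≤ K := by exact_mod_cast ha
  have hb' : (b : ℝ) + 1 ≤ K := by exact_mod_cast hb
  intro k
  obtain ⟨h₁, h₂⟩ := hx k
  refine ⟨le_trans (by positivity) h₁, h₂.trans ((div_le_one hK).2 ?_)⟩
  fin_cases k
  · exact ha'
  · exact hb'

lemma exists_lt_mem_Icc_div {K : ℕ} (hK : 0 < K) {t : ℝ} (ht : t ∈ Set.Icc (0 : ℝ) 1) :
    ∃ a < K, t ∈ Set.Icc ((a : ℝ) / K) ((a + 1 : ℝ) / K) := by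
  have hK' : (0 : ℝ) < K := by exact_mod_cast hK
  rcases ht.2.lt_or_eq with h | rfl
  · have h0 : 0 ≤ t * K := mul_nonneg ht.1 hK'.le
    refine ⟨⌊t * K⌋₊, (Nat.floor_lt h0).2 (by nlinarith), ?_, ?_⟩
    · exact (div_le_iff₀ hK').2 (Nat.floor_le h0)
    · exact (le_div_iff₀ hK').2 (Nat.lt_floor_add_one _).le
  -- At the right endpoint the floor would be `K`, out of range; the last closed cell contains it.
  · have : ((K - 1 : ℕ) : ℝ) = K - 1 := by rw [Nat.cast_sub hK, Nat.cast_one]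
    refine ⟨K - 1, by omega, ?_, ?_⟩
    · rw [this, div_le_one hK']; linarith
    · rw [this, sub_add_cancel, div_self hK'.ne']

lemma exists_mem_gridCell {K : ℕ} (hK : 0 < K) {x : EuclideanSpace ℝ (Fin 2)}
    (hx : x ∈ serviceArea) : ∃ a < K, ∃ b < K, x ∈ gridCell K a b := by
  obtain ⟨a, ha, hxa⟩ := exists_lt_mem_Icc_div hK (hx 0)
  obtain ⟨b, hb, hxb⟩ := exists_lt_mem_Icc_div hK (hx 1)
  exact ⟨a, ha, b, hb, Fin.forall_fin_two.2 ⟨hxa, hxb⟩⟩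

/-- Points in the same cell, or in cells that share a side, are close. -/
lemma dist_le_of_mem_gridCell {K a b a' b' : ℕ} {x y : EuclideanSpace ℝ (Fin 2)}
    (hx : x ∈ gridCell K a b) (hy : y ∈ gridCell K a' b') (ha : a ≤ a') (hb : b ≤ b')
    (hab : a' + b' ≤ a + b + 1) : dist x y ≤ 3 / K := by
  -- Division by zero collapses every cell to the origin when `K = 0`.
  rcases K.eq_zero_or_pos with rfl | hK
  · have h (k : Fin 2) : x k = y k := by
      have h₁ := hx k
      have h₂ := hy k
      simp only [Nat.cast_zero, div_zero, Set.Icc_self, Set.mem_singleton_iff] at h₁ h₂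
      rw [h₁, h₂]
    simpa [h] using dist_le_abs_add_abs x y
  have hK' : (0 : ℝ) < K := by exact_mod_cast hK
  have key {s t : ℝ} {c c' : ℕ} (hc : c ≤ c')
      (hs : s ∈ Set.Icc ((c : ℝ) / K) ((c + 1 : ℝ) / K))
      (ht : t ∈ Set.Icc ((c' : ℝ) / K) ((c' + 1 : ℝ) / K)) :
      |s - t| ≤ ((c' : ℝ) - c + 1) / K := by
    have hc' : (c : ℝ) / K ≤ c' / K := by gcongr
    obtain ⟨h₁, h₂⟩ := hs
    obtain ⟨h₃, h₄⟩ := ht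
    rw [add_div] at *
    rw [sub_div]
    exact abs_le.2 ⟨by linarith, by linarith⟩
  have h₀ := key ha (hx 0) (hy 0)
  have h₁ := key hb (hx 1) (hy 1)
  -- Each coordinate contributes its index shift plus one cell width; the shifts total at most 1,
  -- whence the 3.
  have hab' : (a' : ℝ) + b' ≤ a + b + 1 := by exact_mod_cast hab
  calc dist x y ≤ ((a' : ℝ) - a + 1) / K + ((b' : ℝ) - b + 1) / K :=
        (dist_le_abs_add_abs x y).trans (add_le_add h₀ h₁)
    _ ≤ 3 / K := by
        rw [← add_div]
        gcongr
        linarith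

lemma coverageGraph_reachable_of_dist_lt {n : ℕ} {loc : Fin n → EuclideanSpace ℝ (Fin 2)} {r : ℝ}
    {i j : Fin n} (h : dist (loc i) (loc j) < r) : (coverageGraph loc r).Reachable i j := by
  by_cases hij : i = j
  · exact hij ▸ SimpleGraph.Reachable.refl _
  · exact SimpleGraph.Adj.reachable (show (coverageGraph loc r).Adj i j from ⟨hij, h⟩)

/-- If every cell of a fine enough grid is occupied, the geometric graph is connected. -/
lemma coverageGraph_preconnected_of_occupied {n K : ℕ} (hK : 0 < K)
    {loc : Fin n → EuclideanSpace ℝ (Fin 2)} {r : ℝ} (hr : 3 / K < r)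
    (hloc : ∀ i, loc i ∈ serviceArea)
    (hocc : ∀ a < K, ∀ b < K, ∃ i, loc i ∈ gridCell K a b) :
    (coverageGraph loc r).Preconnected := by
  -- `choose!` needs a default user for cells outside the grid.
  have : Nonempty (Fin n) := (hocc 0 hK 0 hK).nonempty
  choose! u hu using hocc
  have step {i j : Fin n} {a b a' b' : ℕ} (hi : loc i ∈ gridCell K a b)
      (hj : loc j ∈ gridCell K a' b') (ha : a ≤ a') (hb : b ≤ b') (hab : a' + b' ≤ a + b + 1) :
      (coverageGraph loc r).Reachable i j :=
    coverageGraph_reachable_of_dist_lt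
      ((dist_le_of_mem_gridCell hi hj ha hb hab).trans_lt hr)
  have col (a : ℕ) (ha : a < K) : (coverageGraph loc r).Reachable (u 0 0) (u a 0) := by
    induction a with
    | zero => rfl
    | succ a ih =>
      exact (ih (by omega)).trans
        (step (hu a (by omega) 0 hK) (hu (a + 1) ha 0 hK) (by omega) le_rfl (by omega))
  have row (a : ℕ) (ha : a < K) (b : ℕ) (hb : b < K) :
      (coverageGraph loc r).Reachable (u 0 0) (u a b) := by
    induction b with
    | zero => exact col a ha
    | succ b ih =>
      exact (ih (by omega)).trans
        (step (hu a ha b (by omega)) (hu a ha (b + 1) hb) le_rfl (by omega) (by omega))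
  have base (i : Fin n) : (coverageGraph loc r).Reachable (u 0 0) i := by
    obtain ⟨a, ha, b, hb, hi⟩ := exists_mem_gridCell hK (hloc i)
    exact (row a ha b hb).trans (step (hu a ha b hb) hi le_rfl le_rfl (by omega))
  exact fun i j => (base i).symm.trans (base j)

/-- The user `j₁` would lie in both audiences. -/
lemma not_passiveDoubleSpending_of_preconnected {n : ℕ} {loc : Fin n → EuclideanSpace ℝ (Fin 2)}
    {r aVd : ℝ} {mVu : ℕ} (h : (coverageGraph loc r).Preconnected) :
    ¬ PassiveDoubleSpending loc r aVd mVu := by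
  rintro ⟨j₁, j₂, hdisj, -, -⟩
  exact Set.disjoint_left.1 hdisj (h j₁ j₁) (h j₂ j₁)

lemma PassiveDoubleSpending.aVd_lt_two {n : ℕ} {loc : Fin n → EuclideanSpace ℝ (Fin 2)}
    {r aVd : ℝ} {mVu : ℕ} (h : PassiveDoubleSpending loc r aVd mVu)
    (hloc : ∀ i, loc i ∈ serviceArea) : aVd < 2 := by
  obtain ⟨_, _, -, ⟨S, -, -, hS⟩, -⟩ := h
  exact hS.trans_le (averageDistance_le_two hloc S)

lemma ae_locationLaw_mem_serviceArea (n : ℕ) :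
    ∀ᵐ loc ∂locationLaw n, ∀ i, loc i ∈ serviceArea := by
  refine ae_all_iff.2 fun i => ?_
  exact Measure.tendsto_eval_ae_ae.eventually (ae_restrict_mem measurableSet_serviceArea)

/-- The probability that a given cell of the grid is empty. -/
lemma locationLaw_gridCell_empty {K a b : ℕ} (n : ℕ) (ha : a < K) (hb : b < K) :
    locationLaw n {loc | ∀ i, loc i ∉ gridCell K a b} =
      ENNReal.ofReal ((1 - 1 / (K : ℝ) ^ 2) ^ n) := by
  have hK : (1 : ℝ) ≤ K := by exact_mod_cast (Nat.zero_le a).trans_lt ha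
  have hset : {loc : Fin n → EuclideanSpace ℝ (Fin 2) | ∀ i, loc i ∉ gridCell K a b} =
      Set.univ.pi fun _ => (gridCell K a b)ᶜ := by
    ext loc
    simp
  have hq : 0 ≤ 1 - 1 / (K : ℝ) ^ 2 :=
    sub_nonneg.2 ((div_le_one (by positivity)).2 (one_le_pow₀ hK))
  rw [hset, locationLaw, Measure.pi_pi, Finset.prod_const, Finset.card_univ, Fintype.card_fin,
    prob_compl_eq_one_sub (measurableSet_gridCell K a b),
    Measure.restrict_apply (measurableSet_gridCell K a b),
    Set.inter_eq_left.2 (gridCell_subset_serviceArea ha hb), volume_gridCell,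
    ← ENNReal.ofReal_one, ← ENNReal.ofReal_sub _ (by positivity), ENNReal.ofReal_pow hq]

/-- The geometric graph is disconnected with exponentially small probability, uniformly over
radii bounded below. -/
lemma locationLaw_not_preconnected_le {K : ℕ} (hK : 0 < K) (n : ℕ) {r : ℝ} (hr : 3 / K < r) :
    locationLaw n {loc | ¬ (coverageGraph loc r).Preconnected} ≤
      ENNReal.ofReal ((K : ℝ) ^ 2 * (1 - 1 / (K : ℝ) ^ 2) ^ n) := by
  calc locationLaw n {loc | ¬ (coverageGraph loc r).Preconnected}
      ≤ locationLaw n (⋃ p ∈ Finset.range K ×ˢ Finset.range K,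
          {loc | ∀ i, loc i ∉ gridCell K p.1 p.2}) := by
        -- The inclusion holds only up to a null set: users must lie in the square to be assigned
        -- cells.
        refine measure_mono_ae ?_
        filter_upwards [ae_locationLaw_mem_serviceArea n] with loc hloc hnot
        by_contra hocc
        refine hnot (coverageGraph_preconnected_of_occupied hK hr hloc fun a ha b hb => ?_)
        by_contra! hempty
        exact hocc (Set.mem_biUnion (x := (a, b)) (by simp [ha, hb]) hempty)
    _ ≤ ∑ p ∈ Finset.range K ×ˢ Finset.range K,
          locationLaw n {loc | ∀ i, loc i ∉ gridCell K p.1 p.2} :=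
        measure_biUnion_finset_le _ _
    _ = ∑ _p ∈ Finset.range K ×ˢ Finset.range K,
          ENNReal.ofReal ((1 - 1 / (K : ℝ) ^ 2) ^ n) := by
        refine Finset.sum_congr rfl fun p hp => ?_
        rw [Finset.mem_product, Finset.mem_range, Finset.mem_range] at hp
        exact locationLaw_gridCell_empty n hp.1 hp.2
    _ = ENNReal.ofReal ((K : ℝ) ^ 2 * (1 - 1 / (K : ℝ) ^ 2) ^ n) := by
        rw [Finset.sum_const, Finset.card_product, Finset.card_range, nsmul_eq_mul,
          ENNReal.ofReal_mul (by positivity), ← sq, ← Nat.cast_pow (α := ℝ) K 2,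
          ENNReal.ofReal_natCast]

/-- The parameter `d` is the degree `d_𝒟 = (1 + o(1)) π n r²`; the `o(1)` is the null sequence
`ε`, and only the upper bound on `d` is required. The threshold `N` depends on `ε` alone. -/
theorem mainTheorem1 (ε : ℕ → ℝ) (hε : Tendsto ε atTop (𝓝 0)) :
    ∃ N : ℕ, ∀ n : ℕ, N ≤ n → ∀ (r aVd lam d : ℝ) (mVu : ℕ),
      0 < r → 0 < aVd → lam = aVd / r →
      d ≤ Real.pi * (n : ℝ) * r ^ 2 * (1 + ε n) →
      (n : ℝ) * (aVd / lam) ^ 2 ≥ 2 * Real.log (n : ℝ) →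
      lam * d > (n : ℝ) / 2 →
      locationLaw n {loc | PassiveDoubleSpending loc r aVd mVu}
        ≤ ENNReal.ofReal (1 / (n : ℝ) ^ 2) := by
  -- Exponential decay beats `n^2`; the threshold 1/2500 below absorbs the number of cells.
  have hlim := tendsto_pow_const_mul_const_pow_of_abs_lt_one (r := 1 - 1 / ((50 : ℕ) : ℝ) ^ 2) 2
    (by norm_num [abs_lt])
  obtain ⟨N, hN⟩ := eventually_atTop.1
    ((hε.eventually_lt_const (show (0 : ℝ) < 1 / 20 by norm_num)).and
      ((hlim.eventually_lt_const (show (0 : ℝ) < 1 / 2500 by norm_num)).and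
        (eventually_ge_atTop 1)))
  refine ⟨N, fun n hn r aVd lam d mVu hr haVd hlam hd _ hlamd => ?_⟩
  obtain ⟨hεn, hdecay, hn1⟩ := hN n hn
  have hn0 : (0 : ℝ) < n := by exact_mod_cast hn1
  by_cases h2 : aVd < 2
  -- With `π < 3.15`, `aVd < 2` and `ε n < 1/20`, `r > 1 / (2 · 3.15 · 2 · 1.05) ≈ 0.0756`, which
  -- leaves room above 0.06.
  · have hr' : 3 / ((50 : ℕ) : ℝ) < r := by
      have h₁ : (n : ℝ) / 2 < n * (Real.pi * (aVd * r * (1 + ε n))) := by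
        calc (n : ℝ) / 2 < lam * d := hlamd
          _ ≤ lam * (Real.pi * n * r ^ 2 * (1 + ε n)) :=
            mul_le_mul_of_nonneg_left hd (hlam ▸ by positivity)
          _ = n * (Real.pi * (aVd * r * (1 + ε n))) := by
            rw [hlam]
            field_simp
      have h₂ : 1 / 2 < Real.pi * (aVd * r * (1 + ε n)) := by
        refine lt_of_mul_lt_mul_left ?_ hn0.le
        linarith
      have h₃ : Real.pi * (aVd * r * (1 + ε n)) ≤ 3.15 * (2 * r * (21 / 20)) := by
        calc Real.pi * (aVd * r * (1 + ε n)) ≤ Real.pi * (aVd * r * (21 / 20)) := by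
              gcongr
              linarith
          _ ≤ 3.15 * (2 * r * (21 / 20)) := by
              gcongr
              exact Real.pi_lt_d2.le
      norm_num at h₃ ⊢
      linarith
    calc locationLaw n {loc | PassiveDoubleSpending loc r aVd mVu}
        ≤ locationLaw n {loc | ¬ (coverageGraph loc r).Preconnected} :=
          measure_mono fun _ h hc => not_passiveDoubleSpending_of_preconnected hc h
      _ ≤ _ := locationLaw_not_preconnected_le (by norm_num) n hr'
      _ ≤ ENNReal.ofReal (1 / (n : ℝ) ^ 2) := by
          refine ENNReal.ofReal_le_ofReal ((le_div_iff₀ (by positivity)).2 ?_)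
          norm_num at hdecay ⊢
          linarith
  · have hnull : locationLaw n {loc | PassiveDoubleSpending loc r aVd mVu} = 0 := by
      refine measure_eq_zero_iff_ae_notMem.2 ?_
      filter_upwards [ae_locationLaw_mem_serviceArea n] with loc hloc h
      exact h2 (h.aVd_lt_two hloc)
    rw [hnull]
    exact zero_le
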